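/- **Setting.** For probability measures (cdf's) $F,G$ on $\mathbb R$ let $d_{CvM}(F,G)=\int_{-\infty}^{\infty}(F(z)-G(z))^2\,G(dz)$. For $a>0$ and a probability measure $H$ on $\mathbb R$, a random probability measure $P$ is a Dirichlet process $DP(a,H)$ if for every finite measurable partition $A_1,\dots,A_k$ ($k\ge 2$) of $\mathbb R$ the vector $(P(A_1),\dots,P(A_k))$ has the Dirichlet$(aH(A_1),\dots,aH(A_k))$ distribution, where a coordinate with parameter $0$ is $0$ almost surely. Let $x_1,x_2,\dots$ be i.i.d. with continuous cdf $F$ and let $y_1,y_2,\dots$ be i.i.d. with continuous cdf $G$, the two sequences being independent. Let $a_1,a_2>0$ and let $H_1,H_2$ be probability measures on $\mathbb R$. The prior is $P\sim DP(a_1,H_1)$, $Q\sim DP(a_2,H_2)$, independent; the prior law $\Pi_D$ is the law of $D=d_{CvM}(P,Q)$. Given $x_1,\dots,x_{n_1}$ and $y_1,\dots,y_{n_2}$, the posterior is $P_x\sim DP(a_1+n_1,H_x)$, $Q_y\sim DP(a_2+n_2,H_y)$, independent, with $H_x=\frac{a_1}{a_1+n_1}H_1+\frac{1}{a_1+n_1}\sum_{i\le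 n_1}\delta_{x_i}$ and $H_y=\frac{a_2}{a_2+n_2}H_2+\frac{1}{a_2+n_2}\sum_{j\le n_2}\delta_{y_j}$; the posterior law $\Pi_D(\cdot\mid x,y)$ is the law of $d_{CvM}(P_x,Q_y)$. Let $1\le i_0<M$ be integers, let $d_p=\inf\{t:\Pi_D((-\infty,t])\ge p\}$ be the $p$-th prior quantile of $D$, and consider the discretization of $[0,\infty)$ into the cells $[0,d_{i_0/M})$, $[d_{i_0/M},d_{(i_0+1)/M})$, $\dots$, $[d_{(M-1)/M},\infty)$ (the cell with index $i=M-1$ is the last one). Assume that every cell has positive prior content. For a cell $C$ let $RB_D(C\mid x,y)=\Pi_D(C\mid x,y)/\Pi_D(C)$; for a point $d\ge 0$ let $RB_D(d\mid x,y)$ be the relative belief ratio of the cell that contains $d$. The strength is $\Pi_D\big(\{d: RB_D(d\mid x,y)\le RB_D(0\mid x,y)\}\mid x,y\big)$. **Proposition.** As $n_1,n_2\to\infty$ (jointly, in any manner), almost surely with respect to the data: (i) if $F=G$, then $RB_D([0,d_{i_0/M})\mid x,y)\to 1/\Pi_D([0,d_{i_0/M}))$; $RB_D([d_{i/M},d_{(i+1)/M})\mid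 x,y)\to 0$ for every $i_0\le i\le M-1$ (with $[d_{(M-1)/M},\infty)$ for $i=M-1$); and the strength tends to $1$; (ii) if $F\neq G$ and $d_{CvM}(F,G)>d_{i_0/M}$, then $RB_D([0,d_{i_0/M})\mid x,y)\to 0$ and the strength tends to $0$. -/

import Mathlib

open MeasureTheory ProbabilityTheory Filter Topology Set

noncomputable section

/-- The Dirichlet distribution with parameters `α i ≥ 0` (not all zero) on `ι → ℝ`: the law of
`(g i / ∑ j, g j)` for independent `g i ~ Gamma(α i, 1)`, where `Gamma(0, 1)` is the point mass
at `0` (so a coordinate with parameter `0` vanishes almost surely). -/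
def dirichletMeasure {ι : Type*} [Fintype ι] (α : ι → ℝ) : Measure (ι → ℝ) :=
  (Measure.pi fun i => if α i = 0 then Measure.dirac (0 : ℝ) else gammaMeasure (α i) 1).map
    fun g i => g i / ∑ j, g j

/-- `law` is the law of a Dirichlet process `DP(a, H)` on `ℝ`: for every finite measurable
partition `A 0, …, A (k - 1)` of `ℝ`, the vector `(P (A 0), …, P (A (k - 1)))` has the Dirichlet
distribution with parameters `a * H (A i)`. -/
structure IsDirichletProcess (a : ℝ) (H : Measure ℝ) (law : Measure (ProbabilityMeasure ℝ)) :
    Prop where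
  isProbabilityMeasure : IsProbabilityMeasure law
  map_partition : ∀ (k : ℕ) (A : Fin k → Set ℝ), 2 ≤ k → (∀ i, MeasurableSet (A i)) →
    Pairwise (fun i j => Disjoint (A i) (A j)) → (⋃ i, A i) = univ →
    law.map (fun (P : ProbabilityMeasure ℝ) i => (P : Measure ℝ).real (A i)) = dirichletMeasure fun i => a * H.real (A i)

/-- The base measure `H_x = a / (a + n) * H + n / (a + n) * F_n` of the posterior Dirichlet
process given a sample `u` of size `n` with empirical distribution `F_n`. -/
def posteriorBase (a : ℝ) (H : Measure ℝ) {n : ℕ} (u : Fin n → ℝ) : Measure ℝ :=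
  ENNReal.ofReal (a / (a + n)) • H + ENNReal.ofReal (1 / (a + n)) • ∑ i, Measure.dirac (u i)

/-- The Cramér-von Mises distance `∫ (F(z) - G(z))² G(dz)`. -/
def cvmDist (F G : Measure ℝ) : ℝ := ∫ z, (cdf F z - cdf G z) ^ 2 ∂G

/-- The law of the Cramér-von Mises distance `d(P, Q)` for independent random probability
measures `P ~ lawP` and `Q ~ lawQ`. -/
def cvmLaw (lawP lawQ : Measure (ProbabilityMeasure ℝ)) : Measure ℝ :=
  (lawP.prod lawQ).map fun p => cvmDist (p.1 : Measure ℝ) (p.2 : Measure ℝ)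

/-- The `p`-th quantile `inf {t | ν (-∞, t] ≥ p}` of a law on the real line. -/
def quantile (ν : Measure ℝ) (p : ℝ) : ℝ := sInf {t : ℝ | p ≤ cdf ν t}

/-- The cell `[0, d_{i₀/M})`, where `d_p` is the `p`-th quantile of `ν`. -/
def firstCell (ν : Measure ℝ) (M i₀ : ℕ) : Set ℝ := Ico 0 (quantile ν ((i₀ : ℝ) / M))

/-- The cell `[d_{i/M}, d_{(i+1)/M})`; the last one, `i = M - 1`, is `[d_{(M-1)/M}, ∞)`. -/
def cell (ν : Measure ℝ) (M i : ℕ) : Set ℝ :=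
  if i + 1 = M then Ici (quantile ν ((i : ℝ) / M))
  else Ico (quantile ν ((i : ℝ) / M)) (quantile ν (((i + 1 : ℕ) : ℝ) / M))

/-- The discretization `{[0, d_{i₀/M}), [d_{i₀/M}, d_{(i₀+1)/M}), …, [d_{(M-1)/M}, ∞)}`. -/
def discretization (ν : Measure ℝ) (M i₀ : ℕ) : Set (Set ℝ) :=
  {C | C = firstCell ν M i₀ ∨ ∃ i, i₀ ≤ i ∧ i < M ∧ C = cell ν M i}

/-- The relative belief ratio of `C`: posterior content over prior content. -/
def relativeBelief (prior posterior : Measure ℝ) (C : Set ℝ) : ℝ :=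
  posterior.real C / prior.real C

/-- The strength: the posterior probability that the relative belief ratio at `d` is at most the
relative belief ratio at `0`, where the ratio at a point is that of the cell containing it. -/
def strength (prior posterior : Measure ℝ) (M i₀ : ℕ) : ℝ :=
  posterior.real {d | ∃ C ∈ discretization prior M i₀, d ∈ C ∧
    relativeBelief prior posterior C ≤ relativeBelief prior posterior (firstCell prior M i₀)}

end

/-!
The whole proposition follows from posterior consistency of `D`: almost surely, the posterior law
of `D = d(P, Q)` concentrates at `d(F, G)` (`ae_tendsto_cvmLaw_le_abs_sub`).

*Consistency on one half-line.* A Dirichlet process `DP(a, H)` gives a measurable set `A` a mass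
`g₀ / (g₀ + g₁)` with `g₀`, `g₁` Gamma variables of total shape `a`. A Gamma variable has variance
equal to its shape, so by Chebyshev's inequality both are within `η a` of their means outside an
event of probability at most `1 / (η² a)`, and then `P(A)` is within `2 η` of `H(A)`
(`IsDirichletProcess.measure_le_abs_sub`). The joint law of `g₀` and `g₁` plays no role. The
posterior base measure of `A` converges almost surely to the true probability of `A` by the strong
law of large numbers (`ae_tendsto_posteriorBase_real`).

*From finitely many half-lines to the distance.* As the true cdf's are continuous, Pólya's argument
makes closeness at finitely many points imply uniform closeness of cdf's
(`exists_finset_forall_abs_cdf_sub_le`), and `d` is Lipschitz for the uniform distance at `(F, G)`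
(`abs_cvmDist_sub_cvmDist_le`). For the latter, the change of the integrating measure is controlled
by expanding `(F - G)²` into the monotone continuous functions `F²`, `F G`, `G²`, to which the layer
cake formula applies.

*The relative belief ratios.* If `F = G`, then `D` concentrates at `0`, which lies inside the first
cell because that cell has positive prior content; all other cells lie to its right, and the
strength is at least the posterior content of the first cell. If `d(F, G)` exceeds the right end of
the first cell, the ratio `r` of that cell tends to `0`; a cell counted by the strength has
posterior content at most `r`, and there are finitely many cells (`strength_le`).
-/

/-! ### Concentration of Gamma and Dirichlet distributions -/

/-- The variance of `Gamma(α, 1)` is `α`, written with the unnormalized density. -/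
lemma integral_sub_sq_mul_gamma_density {α : ℝ} (hα : 0 < α) :
    IntegrableOn (fun x => (x - α) ^ 2 * (Real.exp (-x) * x ^ (α - 1))) (Ioi 0) ∧
      ∫ x in Ioi 0, (x - α) ^ 2 * (Real.exp (-x) * x ^ (α - 1)) = α * Real.Gamma α := by
  have h0 := Real.GammaIntegral_convergent hα
  have h1 := Real.GammaIntegral_convergent (show 0 < α + 1 by linarith)
  have h2 := Real.GammaIntegral_convergent (show 0 < α + 1 + 1 by linarith)
  have hexpand : EqOn
      (fun x => Real.exp (-x) * x ^ (α + 1 + 1 - 1)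
        + (-(2 * α) * (Real.exp (-x) * x ^ (α + 1 - 1))
          + α ^ 2 * (Real.exp (-x) * x ^ (α - 1))))
      (fun x => (x - α) ^ 2 * (Real.exp (-x) * x ^ (α - 1))) (Ioi 0) := by
    intro x hx
    have hx0 : x ≠ 0 := (mem_Ioi.1 hx).ne'
    have e1 : x ^ (α + 1 - 1) = x ^ (α - 1) * x := by
      rw [← Real.rpow_add_one hx0]; ring_nf
    have e2 : x ^ (α + 1 + 1 - 1) = x ^ (α - 1) * x * x := by
      rw [← Real.rpow_add_one hx0, ← Real.rpow_add_one hx0]; ring_nf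
    simp only [e1, e2]
    ring
  have hint : IntegrableOn (fun x => -(2 * α) * (Real.exp (-x) * x ^ (α + 1 - 1))
      + α ^ 2 * (Real.exp (-x) * x ^ (α - 1))) (Ioi 0) :=
    (h1.const_mul (-(2 * α))).add (h0.const_mul (α ^ 2))
  refine ⟨(h2.add hint).congr_fun hexpand measurableSet_Ioi, ?_⟩
  rw [← setIntegral_congr_fun measurableSet_Ioi hexpand, integral_add h2 hint,
    integral_add (h1.const_mul _) (h0.const_mul _), integral_const_mul, integral_const_mul,
    ← Real.Gamma_eq_integral hα, ← Real.Gamma_eq_integral (by linarith : 0 < α + 1),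
    ← Real.Gamma_eq_integral (by linarith : 0 < α + 1 + 1),
    Real.Gamma_add_one (by linarith : α + 1 ≠ 0), Real.Gamma_add_one hα.ne']
  ring

/-- Chebyshev's inequality for `Gamma(α, 1)`, whose mean and variance are both `α`. -/
lemma gammaMeasure_le_abs_sub {α c : ℝ} (hα : 0 < α) (hc : 0 < c) :
    gammaMeasure α 1 {x | c ≤ |x - α|} ≤ ENNReal.ofReal (α / c ^ 2) := by
  obtain ⟨hint, hval⟩ := integral_sub_sq_mul_gamma_density hα
  have hΓ := Real.Gamma_pos_of_pos hα
  have hae : gammaMeasure α 1 (Iic 0) = 0 := by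
    rw [gammaMeasure, withDensity_apply _ measurableSet_Iic,
      setLIntegral_congr Iio_ae_eq_Iic.symm]
    exact lintegral_gammaPDF_of_nonpos le_rfl
  have hS : MeasurableSet {x : ℝ | c ≤ |x - α|} :=
    measurableSet_le measurable_const (by fun_prop)
  calc gammaMeasure α 1 {x | c ≤ |x - α|}
      ≤ gammaMeasure α 1 ({x | c ≤ |x - α|} ∩ Ioi 0) + gammaMeasure α 1 (Iic 0) := by
        refine (measure_mono fun x hx => ?_).trans (measure_union_le _ _)
        rcases le_or_gt x 0 with h | h
        exacts [Or.inr h, Or.inl ⟨hx, h⟩]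
    _ = ∫⁻ x in {x | c ≤ |x - α|} ∩ Ioi 0, gammaPDF α 1 x := by
        rw [hae, add_zero, gammaMeasure, withDensity_apply _ (hS.inter measurableSet_Ioi)]
    _ ≤ ∫⁻ x in {x | c ≤ |x - α|} ∩ Ioi 0, ENNReal.ofReal
          (1 / (Real.Gamma α * c ^ 2) * ((x - α) ^ 2 * (Real.exp (-x) * x ^ (α - 1)))) := by
        refine setLIntegral_mono' (hS.inter measurableSet_Ioi) fun x hx => ?_
        have hx0 : 0 < x := hx.2
        rw [gammaPDF_of_nonneg hx0.le]
        refine ENNReal.ofReal_le_ofReal ?_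
        have hsq : c ^ 2 ≤ (x - α) ^ 2 := by
          rw [← sq_abs (x - α)]
          exact pow_le_pow_left₀ hc.le hx.1 2
        have hw : 0 ≤ Real.exp (-x) * x ^ (α - 1) := by positivity
        rw [Real.one_rpow, one_mul]
        have : 1 / Real.Gamma α * x ^ (α - 1) * Real.exp (-x)
            = 1 / (Real.Gamma α * c ^ 2) * (c ^ 2 * (Real.exp (-x) * x ^ (α - 1))) := by
          field_simp
        rw [this]
        gcongr
    _ ≤ ∫⁻ x in Ioi 0, ENNReal.ofReal
          (1 / (Real.Gamma α * c ^ 2) * ((x - α) ^ 2 * (Real.exp (-x) * x ^ (α - 1)))) :=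
        lintegral_mono_set inter_subset_right
    _ = ENNReal.ofReal (α / c ^ 2) := by
        rw [← ofReal_integral_eq_lintegral_ofReal (hint.const_mul _), integral_const_mul, hval]
        · congr 1
          field_simp
        · refine (ae_restrict_iff' measurableSet_Ioi).2 (ae_of_all _ fun x (hx : 0 < x) => ?_)
          simp only [Pi.zero_apply]
          positivity

/-- The `i`-th factor in the definition of `dirichletMeasure`. -/
noncomputable def gammaOrDirac (α : ℝ) : Measure ℝ :=
  if α = 0 then Measure.dirac (0 : ℝ) else gammaMeasure α 1

lemma isProbabilityMeasure_gammaOrDirac {α : ℝ} (hα : 0 ≤ α) :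
    IsProbabilityMeasure (gammaOrDirac α) := by
  unfold gammaOrDirac
  split_ifs with h
  · infer_instance
  · exact isProbabilityMeasure_gammaMeasure (lt_of_le_of_ne hα (Ne.symm h)) one_pos

lemma gammaOrDirac_le_abs_sub {α c : ℝ} (hα : 0 ≤ α) (hc : 0 < c) :
    gammaOrDirac α {x | c ≤ |x - α|} ≤ ENNReal.ofReal (α / c ^ 2) := by
  unfold gammaOrDirac
  split_ifs with h
  · have : MeasurableSet {x : ℝ | c ≤ |x - α|} :=
      measurableSet_le measurable_const (by fun_prop)
    rw [Measure.dirac_apply' _ this]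
    simp [h, hc]
  · exact gammaMeasure_le_abs_sub (lt_of_le_of_ne hα (Ne.symm h)) hc

/-- If both Gamma variables are within `η * s` of their means, then their normalization is within
`2 * η` of the normalized means. -/
lemma abs_div_sub_div_lt {g₀ g₁ α₀ α₁ η s : ℝ} (h₀ : 0 ≤ α₀) (h₁ : 0 ≤ α₁) (hs : α₀ + α₁ = s)
    (hs0 : 0 < s) (hη : η ≤ 1 / 4) (hg₀ : |g₀ - α₀| < η * s) (hg₁ : |g₁ - α₁| < η * s) :
    |g₀ / (g₀ + g₁) - α₀ / s| < 2 * η := by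
  rw [abs_lt] at hg₀ hg₁
  have hη0 : 0 < η := by nlinarith
  have hden : s / 2 ≤ g₀ + g₁ := by nlinarith
  have hden0 : 0 < g₀ + g₁ := by linarith
  have hkey : |g₀ * s - (g₀ + g₁) * α₀| < η * s * s := by
    have e : g₀ * s - (g₀ + g₁) * α₀ = α₁ * (g₀ - α₀) - α₀ * (g₁ - α₁) := by
      rw [← hs]; ring
    rw [e, abs_lt]
    have a1 : 0 ≤ α₁ * (η * s - (g₀ - α₀)) := mul_nonneg h₁ (by linarith)
    have a2 : 0 ≤ α₁ * (g₀ - α₀ + η * s) := mul_nonneg h₁ (by linarith)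
    have a3 : 0 ≤ α₀ * (η * s - (g₁ - α₁)) := mul_nonneg h₀ (by linarith)
    have a4 : 0 ≤ α₀ * (g₁ - α₁ + η * s) := mul_nonneg h₀ (by linarith)
    have e2 : η * s * s = α₁ * (η * s) + α₀ * (η * s) := by
      rw [← add_mul, add_comm α₁, hs]; ring
    rcases h₀.lt_or_eq with hp | hp
    · have a5 : 0 < α₀ * (η * s - (g₁ - α₁)) := mul_pos hp (by linarith)
      have a6 : 0 < α₀ * (g₁ - α₁ + η * s) := mul_pos hp (by linarith)
      constructor <;> linarith
    · have hp1 : 0 < α₁ := by linarith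
      have a5 : 0 < α₁ * (η * s - (g₀ - α₀)) := mul_pos hp1 (by linarith)
      have a6 : 0 < α₁ * (g₀ - α₀ + η * s) := mul_pos hp1 (by linarith)
      constructor <;> linarith
  rw [div_sub_div _ _ hden0.ne' hs0.ne', abs_div, abs_of_pos (mul_pos hden0 hs0),
    div_lt_iff₀ (mul_pos hden0 hs0)]
  refine hkey.trans_le ?_
  nlinarith [mul_nonneg (mul_nonneg hη0.le hs0.le) (sub_nonneg.2 hden)]

/-- A two-coordinate Dirichlet distribution of total parameter `s` concentrates at its mean as `s`
grows; only the marginals of the underlying Gamma variables enter. -/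
lemma dirichletMeasure_le_abs_sub {α : Fin 2 → ℝ} (hα : ∀ i, 0 ≤ α i) {s η : ℝ}
    (hs : α 0 + α 1 = s) (hs0 : 0 < s) (hη0 : 0 < η) (hη : η ≤ 1 / 4) :
    dirichletMeasure α {v | 2 * η ≤ |v 0 - α 0 / s|} ≤ ENNReal.ofReal (1 / (η ^ 2 * s)) := by
  have hprob := fun i => isProbabilityMeasure_gammaOrDirac (hα i)
  have hηs : 0 < η * s := mul_pos hη0 hs0
  have hmarg : ∀ i, (Measure.pi fun i => gammaOrDirac (α i)) {g | η * s ≤ |g i - α i|}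
      ≤ ENNReal.ofReal (α i / (η * s) ^ 2) := by
    intro i
    have hm : MeasurableSet {x : ℝ | η * s ≤ |x - α i|} :=
      measurableSet_le measurable_const (by fun_prop)
    have := (measurePreserving_eval (fun i => gammaOrDirac (α i)) i).measure_preimage
      hm.nullMeasurableSet
    exact this.trans_le (gammaOrDirac_le_abs_sub (hα i) hηs)
  change (Measure.map _ (Measure.pi fun i => gammaOrDirac (α i))) _ ≤ _
  rw [Measure.map_apply (by fun_prop) (measurableSet_le measurable_const (by fun_prop))]
  calc _ ≤ (Measure.pi fun i => gammaOrDirac (α i))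
        ({g | η * s ≤ |g 0 - α 0|} ∪ {g | η * s ≤ |g 1 - α 1|}) := by
        refine measure_mono fun g hg => ?_
        simp only [mem_preimage, mem_ofPred_eq, Fin.sum_univ_two] at hg
        by_contra hcon
        simp only [mem_union, mem_ofPred_eq, not_or, not_le] at hcon
        exact absurd (abs_div_sub_div_lt (hα 0) (hα 1) hs hs0 hη hcon.1 hcon.2) (not_lt.2 hg)
    _ ≤ ENNReal.ofReal (α 0 / (η * s) ^ 2) + ENNReal.ofReal (α 1 / (η * s) ^ 2) :=
        (measure_union_le _ _).trans (add_le_add (hmarg 0) (hmarg 1))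
    _ = ENNReal.ofReal (1 / (η ^ 2 * s)) := by
        rw [← ENNReal.ofReal_add (div_nonneg (hα 0) (sq_nonneg _))
          (div_nonneg (hα 1) (sq_nonneg _)), ← add_div, hs]
        congr 1
        field_simp

/-! ### Concentration of Dirichlet processes -/

lemma measurable_probabilityMeasure_real {A : Set ℝ} (hA : MeasurableSet A) :
    Measurable fun P : ProbabilityMeasure ℝ => (P : Measure ℝ).real A :=
  ((Measure.measurable_coe hA).comp measurable_subtype_coe).ennreal_toReal

lemma IsDirichletProcess.measure_le_abs_sub {a : ℝ} {H : Measure ℝ} [IsProbabilityMeasure H]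
    {law : Measure (ProbabilityMeasure ℝ)} (h : IsDirichletProcess a H law) (ha : 0 < a)
    {A : Set ℝ} (hA : MeasurableSet A) {η : ℝ} (hη0 : 0 < η) (hη : η ≤ 1 / 4) :
    law {P | 2 * η ≤ |(P : Measure ℝ).real A - H.real A|} ≤ ENNReal.ofReal (1 / (η ^ 2 * a)) := by
  have hmeas : ∀ i, MeasurableSet ((![A, Aᶜ] : Fin 2 → Set ℝ) i) := by
    intro i; fin_cases i
    exacts [hA, hA.compl]
  have hmap := h.map_partition 2 ![A, Aᶜ] le_rfl hmeas
    (by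
      intro i j hij
      fin_cases i <;> fin_cases j <;> simp_all [disjoint_compl_right, disjoint_compl_left])
    (by
      ext z
      simp [Fin.exists_fin_two, em])
  have hsum : a * H.real ((![A, Aᶜ] : Fin 2 → Set ℝ) 0)
      + a * H.real ((![A, Aᶜ] : Fin 2 → Set ℝ) 1) = a := by
    have := probReal_add_probReal_compl (μ := H) hA
    simp only [Matrix.cons_val_zero, Matrix.cons_val_one]
    rw [← mul_add, this, mul_one]
  have hD := dirichletMeasure_le_abs_sub
    (α := fun i => a * H.real ((![A, Aᶜ] : Fin 2 → Set ℝ) i))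
    (fun i => mul_nonneg ha.le measureReal_nonneg) hsum ha hη0 hη
  rw [← hmap, Measure.map_apply
    (measurable_pi_lambda _ fun i => measurable_probabilityMeasure_real (hmeas i))
    (measurableSet_le measurable_const (by fun_prop))] at hD
  simpa [mul_div_cancel_left₀ _ ha.ne'] using hD

/-- Dirichlet processes whose concentration parameters tend to infinity and whose base measures
converge on `A` concentrate at the limit on `A`. -/
lemma tendsto_measure_le_abs_sub_of_isDirichletProcess {a : ℕ → ℝ} {H : ℕ → Measure ℝ}
    [∀ n, IsProbabilityMeasure (H n)] {law : ℕ → Measure (ProbabilityMeasure ℝ)}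
    (h : ∀ n, IsDirichletProcess (a n) (H n) (law n)) (ha : ∀ n, 0 < a n)
    (ha' : Tendsto a atTop atTop) {A : Set ℝ} (hA : MeasurableSet A) {c : ℝ}
    (hc : Tendsto (fun n => (H n).real A) atTop (𝓝 c)) {ε : ℝ} (hε : 0 < ε) :
    Tendsto (fun n => law n {P | ε ≤ |(P : Measure ℝ).real A - c|}) atTop (𝓝 0) := by
  set η := min (ε / 4) (1 / 4) with hη_def
  have hη0 : 0 < η := by positivity
  have hlim : Tendsto (fun n => ENNReal.ofReal (1 / (η ^ 2 * a n))) atTop (𝓝 0) := by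
    rw [← ENNReal.ofReal_zero]
    refine ENNReal.tendsto_ofReal ?_
    exact tendsto_const_nhds.div_atTop (ha'.const_mul_atTop (by positivity))
  refine tendsto_of_tendsto_of_tendsto_of_le_of_le' tendsto_const_nhds hlim
    (Eventually.of_forall fun _ => zero_le) ?_
  filter_upwards [Metric.tendsto_nhds.1 hc (ε / 2) (by linarith)] with n hn
  refine le_trans (measure_mono fun P hP => ?_)
    ((h n).measure_le_abs_sub (ha n) hA hη0 (min_le_right _ _))
  rw [Real.dist_eq] at hn
  simp only [mem_ofPred_eq] at hP ⊢
  have := abs_sub_le ((P : Measure ℝ).real A) ((H n).real A) c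
  have := min_le_left (ε / 4) (1 / 4)
  linarith

/-! ### Uniform approximation of cdf's and continuity of the Cramér-von Mises distance -/

/-- Pólya's argument: closeness to a continuous cdf on a suitable finite set of points forces
uniform closeness. -/
lemma exists_finset_forall_abs_cdf_sub_le (F : Measure ℝ) [IsProbabilityMeasure F]
    (hF : Continuous (cdf F)) {η : ℝ} (hη : 0 < η) :
    ∃ T : Finset ℝ, ∀ P : Measure ℝ, (∀ t ∈ T, |cdf P t - cdf F t| < η) →
      ∀ z, |cdf P z - cdf F z| ≤ 2 * η := by
  obtain ⟨N, hN⟩ := exists_nat_gt (1 / η)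
  have hN0 : (0 : ℝ) < N := (by positivity : (0 : ℝ) < 1 / η).trans hN
  have hNη : 1 < N * η := by rwa [div_lt_iff₀ hη] at hN
  have hsurj : ∀ c ∈ Ioo (0 : ℝ) 1, ∃ t, cdf F t = c := by
    intro c hc
    refine mem_range_of_exists_le_of_exists_ge hF ?_ ?_
    · exact (((tendsto_cdf_atBot F).eventually_lt_const hc.1).exists).imp fun _ h => h.le
    · exact (((tendsto_cdf_atTop F).eventually_const_lt hc.2).exists).imp fun _ h => h.le
  -- `t j` is a quantile of level `j / N`, meaningful for `0 < j < N`
  have : ∀ j : ℕ, ∃ t, 0 < j → j < N → cdf F t = j / N := by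
    intro j
    by_cases hj : 0 < j ∧ j < N
    · obtain ⟨t, ht⟩ := hsurj (j / N)
        ⟨div_pos (by exact_mod_cast hj.1) hN0, (div_lt_one hN0).2 (by exact_mod_cast hj.2)⟩
      exact ⟨t, fun _ _ => ht⟩
    · exact ⟨0, fun h1 h2 => absurd ⟨h1, h2⟩ hj⟩
  choose t ht using this
  refine ⟨(Finset.range N).image t, fun P hP z => ?_⟩
  have hP' : ∀ j, j < N → |cdf P (t j) - cdf F (t j)| < η := fun j hj =>
    hP _ (Finset.mem_image_of_mem _ (Finset.mem_range.2 hj))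
  have hF0 := cdf_nonneg F z
  have hF1 := cdf_le_one F z
  have hP0 := cdf_nonneg P z
  have hP1 := cdf_le_one P z
  set w := N * cdf F z with hw
  have hw0 : 0 ≤ w := by positivity
  rw [abs_le]
  constructor
  · -- the grid point just below `z`
    obtain ⟨j, hj2⟩ : ∃ j : ℕ, w ≤ j + 1 ∧ (0 < j → (j : ℝ) < w) := by
      have hle := Nat.le_ceil w
      have hlt := Nat.ceil_lt_add_one hw0
      rcases Nat.eq_zero_or_pos ⌈w⌉₊ with h0 | h0
      · refine ⟨0, ?_, by simp⟩
        rw [h0] at hle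
        push_cast at hle ⊢
        linarith
      · refine ⟨⌈w⌉₊ - 1, ?_, fun _ => ?_⟩ <;> push_cast [Nat.cast_sub h0] <;> linarith
    rcases Nat.eq_zero_or_pos j with h0 | h0
    · have : w ≤ 1 := by simpa [h0] using hj2.1
      nlinarith
    · have hjN : j < N := by
        have : (j : ℝ) < N := (hj2.2 h0).trans_le (by nlinarith)
        exact_mod_cast this
      have hval := ht j h0 hjN
      have hlt : cdf F (t j) < cdf F z := by
        rw [hval, div_lt_iff₀ hN0, mul_comm]
        exact hj2.2 h0
      have hle : cdf P (t j) ≤ cdf P z :=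
        monotone_cdf P ((monotone_cdf F).reflect_lt hlt).le
      have := (abs_lt.1 (hP' j hjN)).1
      have : cdf F z ≤ cdf F (t j) + η := by
        rw [hval]
        have : cdf F z ≤ (j + 1) / N := by
          rw [le_div_iff₀ hN0, mul_comm]
          exact hj2.1
        have h1 : 1 / (N : ℝ) ≤ η := by
          rw [div_le_iff₀ hN0]
          nlinarith
        rw [add_div] at this
        linarith
      linarith
  · -- the grid point just above `z`
    have hj1 := Nat.floor_le hw0
    have hj2 := Nat.lt_floor_add_one w
    rcases lt_or_ge (⌊w⌋₊ + 1) N with hjN | hjN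
    · have hval := ht _ (Nat.succ_pos _) hjN
      push_cast at hval
      have hlt : cdf F z < cdf F (t (⌊w⌋₊ + 1)) := by
        rw [hval, lt_div_iff₀ hN0, mul_comm]
        exact hj2
      have hle : cdf P z ≤ cdf P (t (⌊w⌋₊ + 1)) :=
        monotone_cdf P ((monotone_cdf F).reflect_lt hlt).le
      have := (abs_lt.1 (hP' _ hjN)).2
      have : cdf F (t (⌊w⌋₊ + 1)) ≤ cdf F z + η := by
        rw [hval, div_le_iff₀ hN0]
        nlinarith
      linarith
    · have : (N : ℝ) ≤ w + 1 := by
        have : (N : ℝ) ≤ (⌊w⌋₊ : ℝ) + 1 := by exact_mod_cast hjN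
        linarith
      have : N * (1 - cdf F z) < N * η := by nlinarith
      have := lt_of_mul_lt_mul_left this hN0.le
      linarith

/-- By the layer cake formula, the integral of a continuous monotone function with values in
`[0, 1]` is an average over `t ∈ (0, 1]` of the measures of its superlevel sets, and each of these
is empty, the whole line or a half-line `Ioi s`. -/
lemma abs_integral_sub_integral_le_of_monotone {Q G : Measure ℝ} [IsProbabilityMeasure Q]
    [IsProbabilityMeasure G] {η : ℝ} (hη : ∀ z, |cdf Q z - cdf G z| ≤ η) {f : ℝ → ℝ}
    (hf : Monotone f) (hfc : Continuous f) (hf0 : ∀ z, 0 ≤ f z) (hf1 : ∀ z, f z ≤ 1) :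
    |∫ z, f z ∂Q - ∫ z, f z ∂G| ≤ η := by
  have hη0 : 0 ≤ η := (abs_nonneg _).trans (hη 0)
  have hint : ∀ (ρ : Measure ℝ) [IsProbabilityMeasure ρ], Integrable f ρ := fun ρ _ =>
    Integrable.of_bound hfc.aestronglyMeasurable 1
      (ae_of_all _ fun z => by rw [Real.norm_of_nonneg (hf0 z)]; exact hf1 z)
  have hlayer : ∀ (ρ : Measure ℝ) [IsProbabilityMeasure ρ],
      ∫ z, f z ∂ρ = ∫ t in Ioc (0 : ℝ) 1, ρ.real {z | t < f z} := by
    intro ρ _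
    rw [(hint ρ).integral_eq_integral_meas_lt (ae_of_all _ hf0)]
    refine setIntegral_eq_of_subset_of_forall_sdiff_eq_zero measurableSet_Ioi
      (fun t ht => ht.1) fun t ht => ?_
    have : {z | t < f z} = ∅ := by
      ext z
      have h1 : 1 < t := by
        by_contra h
        exact ht.2 ⟨ht.1, not_lt.1 h⟩
      simpa using (hf1 z).trans h1.le
    simp [this]
  have hmeasR : ∀ (ρ : Measure ℝ) [IsProbabilityMeasure ρ],
      IntegrableOn (fun t => ρ.real {z | t < f z}) (Ioc (0 : ℝ) 1) := by
    intro ρ _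
    have hanti : Antitone fun t => ρ.real {z | t < f z} := fun s t hst =>
      measureReal_mono fun z (hz : t < f z) => hst.trans_lt hz
    refine Integrable.of_bound hanti.measurable.aestronglyMeasurable 1 (ae_of_all _ fun t => ?_)
    rw [Real.norm_of_nonneg measureReal_nonneg]
    exact measureReal_le_one
  have hset : ∀ t, |Q.real {z | t < f z} - G.real {z | t < f z}| ≤ η := by
    intro t
    have hcompl : {z | t < f z} = {z | f z ≤ t}ᶜ := by ext; simp
    have hcl : IsClosed {z | f z ≤ t} := isClosed_le hfc continuous_const
    rw [hcompl, probReal_compl_eq_one_sub hcl.measurableSet,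
      probReal_compl_eq_one_sub hcl.measurableSet]
    -- a closed lower set is empty, everything, or `Iic s`
    have hcases : {z | f z ≤ t} = ∅ ∨ {z | f z ≤ t} = univ ∨ ∃ s, {z | f z ≤ t} = Iic s := by
      rcases eq_empty_or_nonempty {z | f z ≤ t} with h | h
      · exact Or.inl h
      by_cases hb : BddAbove {z | f z ≤ t}
      · refine Or.inr (Or.inr ⟨sSup {z | f z ≤ t}, ?_⟩)
        ext z
        exact ⟨fun hz => le_csSup hb hz, fun hz => (hf hz).trans (hcl.csSup_mem h hb)⟩
      · refine Or.inr (Or.inl (eq_univ_of_forall fun z => ?_))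
        obtain ⟨w, hw, hzw⟩ := not_bddAbove_iff.1 hb z
        exact (hf hzw.le).trans hw
    rcases hcases with h | h | ⟨s, h⟩
    · simpa [h] using hη0
    · simpa [h] using hη0
    · rw [h, ← cdf_eq_real, ← cdf_eq_real]
      have := hη s
      rw [abs_sub_comm] at this
      simpa using this
  rw [hlayer Q, hlayer G, ← integral_sub (hmeasR Q) (hmeasR G)]
  have := norm_setIntegral_le_of_norm_le_const (μ := volume) (s := Ioc (0 : ℝ) 1) (C := η)
    (f := fun t => Q.real {z | t < f z} - G.real {z | t < f z}) (by simp) (fun t _ => hset t)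
  simpa using this

lemma integrable_of_measurable_of_abs_le_one {ρ : Measure ℝ} [IsProbabilityMeasure ρ] {f : ℝ → ℝ}
    (hf : Measurable f) (hf1 : ∀ z, |f z| ≤ 1) : Integrable f ρ :=
  Integrable.of_bound hf.aestronglyMeasurable 1 (ae_of_all _ hf1)

lemma measurable_cdf (P : Measure ℝ) : Measurable (cdf P) := (monotone_cdf P).measurable

lemma abs_cdf_sub_le_one (P Q : Measure ℝ) (z : ℝ) : |cdf P z - cdf Q z| ≤ 1 := by
  rw [abs_le]
  constructor <;> linarith [cdf_nonneg P z, cdf_le_one P z, cdf_nonneg Q z, cdf_le_one Q z]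

/-- The Cramér-von Mises distance is Lipschitz for the uniform distance of cdf's, at pairs of
measures with continuous cdf's. -/
lemma abs_cvmDist_sub_cvmDist_le {F G P Q : Measure ℝ} [IsProbabilityMeasure F]
    [IsProbabilityMeasure G] [IsProbabilityMeasure P] [IsProbabilityMeasure Q]
    (hF : Continuous (cdf F)) (hG : Continuous (cdf G)) {η : ℝ}
    (hP : ∀ z, |cdf P z - cdf F z| ≤ η) (hQ : ∀ z, |cdf Q z - cdf G z| ≤ η) :
    |cvmDist P Q - cvmDist F G| ≤ 8 * η := by
  have hη0 : 0 ≤ η := (abs_nonneg _).trans (hP 0)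
  have hsq : ∀ (A B ρ : Measure ℝ) [IsProbabilityMeasure ρ],
      Integrable (fun z => (cdf A z - cdf B z) ^ 2) ρ := by
    intro A B ρ _
    refine integrable_of_measurable_of_abs_le_one
      (((measurable_cdf A).sub (measurable_cdf B)).pow_const 2) fun z => ?_
    rw [abs_pow]
    exact pow_le_one₀ (abs_nonneg _) (abs_cdf_sub_le_one A B z)
  -- replacing the integrand
  have h1 : |∫ z, (cdf P z - cdf Q z) ^ 2 ∂Q - ∫ z, (cdf F z - cdf G z) ^ 2 ∂Q| ≤ 4 * η := by
    rw [← integral_sub (hsq P Q Q) (hsq F G Q)]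
    have := norm_integral_le_of_norm_le_const (μ := Q) (C := 4 * η)
      (f := fun z => (cdf P z - cdf Q z) ^ 2 - (cdf F z - cdf G z) ^ 2) (ae_of_all _ fun z => ?_)
    · simpa using this
    · have e : (cdf P z - cdf Q z) ^ 2 - (cdf F z - cdf G z) ^ 2
          = ((cdf P z - cdf F z) - (cdf Q z - cdf G z))
            * ((cdf P z - cdf Q z) + (cdf F z - cdf G z)) := by ring
      rw [Real.norm_eq_abs, e, abs_mul]
      have a1 := (abs_sub (cdf P z - cdf F z) (cdf Q z - cdf G z)).trans (add_le_add (hP z) (hQ z))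
      have a2 := (abs_add_le (cdf P z - cdf Q z) (cdf F z - cdf G z)).trans
        (add_le_add (abs_cdf_sub_le_one P Q z) (abs_cdf_sub_le_one F G z))
      calc _ ≤ (η + η) * (1 + 1) := mul_le_mul a1 a2 (abs_nonneg _) (by linarith)
        _ = 4 * η := by ring
  -- replacing the integrating measure
  have h2 : |∫ z, (cdf F z - cdf G z) ^ 2 ∂Q - ∫ z, (cdf F z - cdf G z) ^ 2 ∂G| ≤ 4 * η := by
    have hprod : ∀ A B : Measure ℝ, Continuous (cdf A) → Continuous (cdf B) →
        |∫ z, cdf A z * cdf B z ∂Q - ∫ z, cdf A z * cdf B z ∂G| ≤ η := fun A B hA hB =>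
      abs_integral_sub_integral_le_of_monotone hQ
        (fun s t hst => mul_le_mul (monotone_cdf A hst) (monotone_cdf B hst) (cdf_nonneg B s)
          (cdf_nonneg A t)) (hA.mul hB)
        (fun z => mul_nonneg (cdf_nonneg A z) (cdf_nonneg B z))
        fun z => mul_le_one₀ (cdf_le_one A z) (cdf_nonneg B z) (cdf_le_one B z)
    have hi : ∀ (A B ρ : Measure ℝ) [IsProbabilityMeasure ρ],
        Integrable (fun z => cdf A z * cdf B z) ρ := fun A B ρ _ =>
      integrable_of_measurable_of_abs_le_one ((measurable_cdf A).mul (measurable_cdf B)) fun z => by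
        rw [abs_of_nonneg (mul_nonneg (cdf_nonneg A z) (cdf_nonneg B z))]
        exact mul_le_one₀ (cdf_le_one A z) (cdf_nonneg B z) (cdf_le_one B z)
    have hexp : ∀ (ρ : Measure ℝ) [IsProbabilityMeasure ρ],
        ∫ z, (cdf F z - cdf G z) ^ 2 ∂ρ = ∫ z, cdf F z * cdf F z ∂ρ
          - 2 * ∫ z, cdf F z * cdf G z ∂ρ + ∫ z, cdf G z * cdf G z ∂ρ := by
      intro ρ _
      have hsub : Integrable (fun z => cdf F z * cdf F z - 2 * (cdf F z * cdf G z)) ρ :=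
        (hi F F ρ).sub ((hi F G ρ).const_mul 2)
      rw [← integral_const_mul, ← integral_sub (hi F F ρ) ((hi F G ρ).const_mul 2),
        ← integral_add hsub (hi G G ρ)]
      refine integral_congr_ae (ae_of_all _ fun z => ?_)
      simp only
      ring
    rw [hexp Q, hexp G]
    have b1 := abs_le.1 (hprod F F hF hF)
    have b2 := abs_le.1 (hprod F G hF hG)
    have b3 := abs_le.1 (hprod G G hG hG)
    rw [abs_le]
    constructor <;> linarith [b1.1, b1.2, b2.1, b2.2, b3.1, b3.2]
  have := abs_sub_le (cvmDist P Q) (∫ z, (cdf F z - cdf G z) ^ 2 ∂Q) (cvmDist F G)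
  unfold cvmDist at *
  linarith

/-! ### Measurability of the Cramér-von Mises distance -/

/-- The identity, as a Markov kernel from probability measures on `ℝ` to `ℝ`. -/
noncomputable def probabilityMeasureKernel : Kernel (ProbabilityMeasure ℝ) ℝ where
  toFun P := P
  measurable' := measurable_subtype_coe

instance : IsMarkovKernel probabilityMeasureKernel :=
  ⟨fun P => inferInstanceAs (IsProbabilityMeasure (P : Measure ℝ))⟩

lemma measurable_cdf_uncurry :
    Measurable fun q : ProbabilityMeasure ℝ × ℝ => cdf (q.1 : Measure ℝ) q.2 := by
  have ht : MeasurableSet {r : (ProbabilityMeasure ℝ × ℝ) × ℝ | r.2 ≤ r.1.2} :=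
    measurableSet_le measurable_snd (measurable_snd.comp measurable_fst)
  have := Kernel.measurable_kernel_prodMk_left
    (κ := probabilityMeasureKernel.comap Prod.fst (measurable_fst (β := ℝ))) ht
  convert this.ennreal_toReal using 2 with q
  rw [cdf_eq_real]
  rfl

lemma measurable_cvmDist :
    Measurable fun p : ProbabilityMeasure ℝ × ProbabilityMeasure ℝ =>
      cvmDist (p.1 : Measure ℝ) (p.2 : Measure ℝ) := by
  have hm : Measurable fun r : (ProbabilityMeasure ℝ × ProbabilityMeasure ℝ) × ℝ =>
      (cdf (r.1.1 : Measure ℝ) r.2 - cdf (r.1.2 : Measure ℝ) r.2) ^ 2 :=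
    ((measurable_cdf_uncurry.comp
      ((measurable_fst.comp measurable_fst).prodMk measurable_snd)).sub
      (measurable_cdf_uncurry.comp
        ((measurable_snd.comp measurable_fst).prodMk measurable_snd))).pow_const 2
  exact (StronglyMeasurable.integral_kernel_prod_right
    (κ := probabilityMeasureKernel.comap Prod.snd (measurable_snd (α := ProbabilityMeasure ℝ)))
    (f := fun p z => (cdf (p.1 : Measure ℝ) z - cdf (p.2 : Measure ℝ) z) ^ 2)
    hm.stronglyMeasurable).measurable

lemma cvmDist_nonneg (P Q : Measure ℝ) : 0 ≤ cvmDist P Q :=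
  integral_nonneg fun _ => sq_nonneg _

/-! ### Posterior base measures -/

lemma isProbabilityMeasure_posteriorBase {a : ℝ} (ha : 0 < a) (H : Measure ℝ)
    [IsProbabilityMeasure H] {n : ℕ} (u : Fin n → ℝ) :
    IsProbabilityMeasure (posteriorBase a H u) := by
  refine ⟨?_⟩
  have h1 : (n : ENNReal) = ENNReal.ofReal n := by simp
  have hn : 0 < a + n := by positivity
  simp only [posteriorBase, Measure.add_apply, Measure.smul_apply, measure_univ,
    Measure.finsetSum_apply, Finset.sum_const, Finset.card_univ, Fintype.card_fin, smul_eq_mul,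
    mul_one, nsmul_eq_mul]
  rw [h1, ← ENNReal.ofReal_mul (by positivity), ← ENNReal.ofReal_add (by positivity)
    (by positivity), ENNReal.ofReal_eq_one]
  field_simp

lemma posteriorBase_real_apply {a : ℝ} (ha : 0 < a) (H : Measure ℝ) [IsProbabilityMeasure H]
    {n : ℕ} (u : Fin n → ℝ) {A : Set ℝ} (hA : MeasurableSet A) :
    (posteriorBase a H u).real A =
      a / (a + n) * H.real A + 1 / (a + n) * ∑ i, A.indicator (fun _ => (1 : ℝ)) (u i) := by
  have hn : 0 < a + n := by positivity
  have hsum : (∑ i, Measure.dirac (u i)).real A = ∑ i, A.indicator (fun _ => (1 : ℝ)) (u i) := by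
    rw [measureReal_def, Measure.finsetSum_apply,
      ENNReal.toReal_sum (fun i _ => measure_ne_top _ _)]
    refine Finset.sum_congr rfl fun i _ => ?_
    rw [Measure.dirac_apply' _ hA]
    by_cases h : u i ∈ A <;> simp [h]
  rw [posteriorBase, measureReal_add_apply
      (ENNReal.mul_ne_top ENNReal.ofReal_ne_top (measure_ne_top _ _))
      (ENNReal.mul_ne_top ENNReal.ofReal_ne_top (measure_ne_top _ _)),
    measureReal_ennreal_smul_apply,
    measureReal_ennreal_smul_apply, hsum, ENNReal.toReal_ofReal (by positivity),
    ENNReal.toReal_ofReal (by positivity)]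

/-- Along almost every sample, the posterior base measure of `A` converges to the true
probability of `A`, by the strong law of large numbers. -/
lemma ae_tendsto_posteriorBase_real {Ω : Type*} [MeasurableSpace Ω] {μ : Measure Ω}
    [IsProbabilityMeasure μ] {F : Measure ℝ} {x : ℕ → Ω → ℝ} (hx : ∀ i, Measurable (x i))
    (hxF : ∀ i, μ.map (x i) = F) (hindep : iIndepFun x μ) {a : ℝ} (ha : 0 < a) (H : Measure ℝ)
    [IsProbabilityMeasure H] {A : Set ℝ} (hA : MeasurableSet A) :
    ∀ᵐ ω ∂μ, Tendsto (fun n : ℕ => (posteriorBase a H fun i : Fin n => x i ω).real A) atTop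
      (𝓝 (F.real A)) := by
  have hind : Measurable (A.indicator fun _ : ℝ => (1 : ℝ)) := measurable_const.indicator hA
  have hslln := strong_law_ae_real (μ := μ)
    (fun i ω => A.indicator (fun _ => (1 : ℝ)) (x i ω))
    (Integrable.of_bound (hind.comp (hx 0)).aestronglyMeasurable 1 (ae_of_all _ fun ω => by
      by_cases h : x 0 ω ∈ A <;> simp [h]))
    (fun i j hij => (hindep.indepFun hij).comp hind hind)
    (fun i => (IdentDistrib.mk (hx i).aemeasurable (hx 0).aemeasurable
      ((hxF i).trans (hxF 0).symm)).comp hind)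
  have hmean : ∫ ω, A.indicator (fun _ => (1 : ℝ)) (x 0 ω) ∂μ = F.real A := by
    rw [← hxF 0, ← integral_map (f := A.indicator fun _ => (1 : ℝ)) (hx 0).aemeasurable
      hind.aestronglyMeasurable, integral_indicator_const _ hA]
    simp
  filter_upwards [hslln] with ω hω
  rw [hmean] at hω
  simp_rw [posteriorBase_real_apply ha H _ hA]
  have hcast : Tendsto (fun n : ℕ => a + (n : ℝ)) atTop atTop :=
    tendsto_atTop_add_const_left _ _ tendsto_natCast_atTop_atTop
  have h0 : Tendsto (fun n : ℕ => a / (a + n)) atTop (𝓝 0) :=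
    tendsto_const_nhds.div_atTop hcast
  have h1 : Tendsto (fun n : ℕ => 1 - a / (a + n)) atTop (𝓝 1) := by
    simpa using tendsto_const_nhds.sub h0
  have hlim := (h0.mul_const (H.real A)).add (h1.mul hω)
  rw [zero_mul, zero_add, one_mul] at hlim
  refine hlim.congr' ?_
  filter_upwards [eventually_gt_atTop 0] with n hn
  have hn' : (0 : ℝ) < n := by exact_mod_cast hn
  rw [Finset.sum_range]
  congr 1
  field_simp
  ring

/-! ### Posterior consistency -/

/-- The posterior Dirichlet processes concentrate, in the uniform distance of cdf's, at the true
distribution. -/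
lemma ae_tendsto_posterior_exists_lt_abs_cdf_sub {Ω : Type*} [MeasurableSpace Ω] {μ : Measure Ω}
    [IsProbabilityMeasure μ] {F : Measure ℝ} [IsProbabilityMeasure F] (hF : Continuous (cdf F))
    {x : ℕ → Ω → ℝ} (hx : ∀ i, Measurable (x i)) (hxF : ∀ i, μ.map (x i) = F)
    (hindep : iIndepFun x μ) {a : ℝ} (ha : 0 < a) (H : Measure ℝ) [IsProbabilityMeasure H]
    {post : (n : ℕ) → (Fin n → ℝ) → Measure (ProbabilityMeasure ℝ)}
    (hpost : ∀ n (u : Fin n → ℝ), IsDirichletProcess (a + n) (posteriorBase a H u) (post n u))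
    {η : ℝ} (hη : 0 < η) :
    ∀ᵐ ω ∂μ, Tendsto (fun n : ℕ => post n (fun i => x i ω)
      {P | ∃ z, η < |cdf (P : Measure ℝ) z - cdf F z|}) atTop (𝓝 0) := by
  obtain ⟨T, hT⟩ := exists_finset_forall_abs_cdf_sub_le F hF (half_pos hη)
  have hae : ∀ᵐ ω ∂μ, ∀ t ∈ T, Tendsto
      (fun n : ℕ => (posteriorBase a H fun i : Fin n => x i ω).real (Iic t)) atTop
      (𝓝 (F.real (Iic t))) :=
    (ae_ball_iff T.countable_toSet).2 fun t _ =>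
      ae_tendsto_posteriorBase_real hx hxF hindep ha H measurableSet_Iic
  filter_upwards [hae] with ω hω
  have := fun n : ℕ => isProbabilityMeasure_posteriorBase ha H fun i : Fin n => x i ω
  have hcast : Tendsto (fun n : ℕ => a + (n : ℝ)) atTop atTop :=
    tendsto_atTop_add_const_left _ _ tendsto_natCast_atTop_atTop
  have hlim := tendsto_finsetSum T fun t ht =>
    tendsto_measure_le_abs_sub_of_isDirichletProcess (fun n => hpost n fun i => x i ω)
      (fun n => by positivity) hcast measurableSet_Iic (hω t ht) (half_pos hη)
  rw [Finset.sum_const_zero] at hlim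
  refine tendsto_of_tendsto_of_tendsto_of_le_of_le tendsto_const_nhds hlim
    (fun _ => zero_le) fun n => ?_
  refine (measure_mono ?_).trans (measure_biUnion_finset_le T _)
  rintro P ⟨z, hz⟩
  by_contra hcon
  simp only [mem_iUnion, mem_ofPred_eq, not_exists, not_le, ← cdf_eq_real] at hcon
  have := hT P hcon z
  linarith

/-- The posterior law of the Cramér-von Mises distance concentrates at the distance of the true
distributions. -/
lemma ae_tendsto_cvmLaw_le_abs_sub {Ω : Type*} [MeasurableSpace Ω] {μ : Measure Ω}
    [IsProbabilityMeasure μ]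
    {F G : Measure ℝ} [IsProbabilityMeasure F] [IsProbabilityMeasure G]
    (hF : Continuous (cdf F)) (hG : Continuous (cdf G))
    {x y : ℕ → Ω → ℝ} (hx : ∀ i, Measurable (x i)) (hy : ∀ j, Measurable (y j))
    (hxF : ∀ i, μ.map (x i) = F) (hyG : ∀ j, μ.map (y j) = G)
    (hxi : iIndepFun x μ) (hyi : iIndepFun y μ)
    {a₁ a₂ : ℝ} (ha₁ : 0 < a₁) (ha₂ : 0 < a₂)
    {H₁ H₂ : Measure ℝ} [IsProbabilityMeasure H₁] [IsProbabilityMeasure H₂]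
    {postP postQ : (n : ℕ) → (Fin n → ℝ) → Measure (ProbabilityMeasure ℝ)}
    (hpostP : ∀ n (u : Fin n → ℝ),
      IsDirichletProcess (a₁ + n) (posteriorBase a₁ H₁ u) (postP n u))
    (hpostQ : ∀ n (u : Fin n → ℝ),
      IsDirichletProcess (a₂ + n) (posteriorBase a₂ H₂ u) (postQ n u))
    {ε : ℝ} (hε : 0 < ε) :
    ∀ᵐ ω ∂μ, Tendsto (fun n : ℕ × ℕ =>
      (cvmLaw (postP n.1 fun i => x i ω) (postQ n.2 fun j => y j ω)).real
        {d | ε ≤ |d - cvmDist F G|}) atTop (𝓝 0) := by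
  have hη : 0 < ε / 9 := by positivity
  filter_upwards [ae_tendsto_posterior_exists_lt_abs_cdf_sub hF hx hxF hxi ha₁ H₁ hpostP hη,
    ae_tendsto_posterior_exists_lt_abs_cdf_sub hG hy hyG hyi ha₂ H₂ hpostQ hη] with ω h₁ h₂
  rw [← ENNReal.toReal_zero]
  refine (ENNReal.tendsto_toReal ENNReal.zero_ne_top).comp ?_
  rw [← prod_atTop_atTop_eq]
  have hlim := (h₁.comp (tendsto_fst (g := (atTop : Filter ℕ)))).add
    (h₂.comp (tendsto_snd (f := (atTop : Filter ℕ))))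
  rw [add_zero] at hlim
  refine tendsto_of_tendsto_of_tendsto_of_le_of_le tendsto_const_nhds hlim
    (fun _ => zero_le) fun n => ?_
  have := (hpostP n.1 fun i => x i ω).isProbabilityMeasure
  have := (hpostQ n.2 fun j => y j ω).isProbabilityMeasure
  rw [cvmLaw, Measure.map_apply measurable_cvmDist
    (measurableSet_le measurable_const (by fun_prop))]
  set B₁ := {P : ProbabilityMeasure ℝ | ∃ z, ε / 9 < |cdf (P : Measure ℝ) z - cdf F z|}
  set B₂ := {Q : ProbabilityMeasure ℝ | ∃ z, ε / 9 < |cdf (Q : Measure ℝ) z - cdf G z|}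
  calc _ ≤ ((postP n.1 fun i => x i ω).prod (postQ n.2 fun j => y j ω))
        (B₁ ×ˢ univ ∪ univ ×ˢ B₂) := by
        refine measure_mono fun p hp => ?_
        by_contra hcon
        simp only [B₁, B₂, mem_union, mem_prod, mem_univ, and_true, true_and, mem_ofPred_eq,
          not_or, not_exists, not_lt] at hcon
        have := abs_cvmDist_sub_cvmDist_le hF hG hcon.1 hcon.2
        simp only [mem_preimage, mem_ofPred_eq] at hp
        linarith
    _ ≤ _ := by
        refine (measure_union_le _ _).trans_eq ?_
        simp [Measure.prod_prod]

/-! ### Cells of the discretization -/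

lemma isProbabilityMeasure_cvmLaw (lawP lawQ : Measure (ProbabilityMeasure ℝ))
    [IsProbabilityMeasure lawP] [IsProbabilityMeasure lawQ] :
    IsProbabilityMeasure (cvmLaw lawP lawQ) :=
  Measure.isProbabilityMeasure_map measurable_cvmDist.aemeasurable

lemma cvmLaw_real_Iio_zero (lawP lawQ : Measure (ProbabilityMeasure ℝ)) :
    (cvmLaw lawP lawQ).real (Iio 0) = 0 := by
  rw [measureReal_def, cvmLaw, Measure.map_apply measurable_cvmDist measurableSet_Iio]
  have : (fun p : ProbabilityMeasure ℝ × ProbabilityMeasure ℝ =>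
      cvmDist (p.1 : Measure ℝ) (p.2 : Measure ℝ)) ⁻¹' Iio 0 = ∅ := by
    ext p
    simpa using cvmDist_nonneg _ _
  simp [this]

lemma quantile_mono (ν : Measure ℝ) {p q : ℝ} (hp : 0 < p) (hpq : p ≤ q) (hq : q < 1) :
    quantile ν p ≤ quantile ν q := by
  refine csInf_le_csInf ?_ ?_ fun t ht => hpq.trans ht
  · obtain ⟨b, hb⟩ := ((tendsto_cdf_atBot ν).eventually_lt_const hp).exists
    exact ⟨b, fun t ht => ((monotone_cdf ν).reflect_lt (hb.trans_le ht)).le⟩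
  · exact (((tendsto_cdf_atTop ν).eventually_const_lt hq).exists).imp fun _ h => h.le

/-- Every cell other than the first lies to the right of the first. -/
lemma cell_subset_Ici (ν : Measure ℝ) {M i₀ i : ℕ} (hi₀ : 1 ≤ i₀) (hi : i₀ ≤ i) (hiM : i < M) :
    cell ν M i ⊆ Ici (quantile ν ((i₀ : ℝ) / M)) := by
  have hM : (0 : ℝ) < M := by exact_mod_cast (by omega : 0 < M)
  have hle : quantile ν ((i₀ : ℝ) / M) ≤ quantile ν ((i : ℝ) / M) := by
    refine quantile_mono ν (div_pos (by exact_mod_cast hi₀) hM) ?_ ?_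
    · gcongr
    · rw [div_lt_one hM]
      exact_mod_cast hiM
  intro d hd
  unfold cell at hd
  split_ifs at hd
  · exact hle.trans hd
  · exact hle.trans hd.1

/-- The cells counted by the strength have posterior content at most the relative belief ratio of
the first cell times their prior content, and there are at most `M + 1` of them. -/
lemma strength_le {prior posterior : Measure ℝ} [IsProbabilityMeasure prior]
    [IsProbabilityMeasure posterior] {M i₀ : ℕ}
    (hcells : ∀ C ∈ discretization prior M i₀, 0 < prior.real C) :
    strength prior posterior M i₀ ≤
      (M + 1) * relativeBelief prior posterior (firstCell prior M i₀) := by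
  set r := relativeBelief prior posterior (firstCell prior M i₀) with hr
  have hr0 : 0 ≤ r := div_nonneg measureReal_nonneg measureReal_nonneg
  have hbound : ∀ C ∈ discretization prior M i₀, relativeBelief prior posterior C ≤ r →
      posterior.real C ≤ r := by
    intro C hC hle
    rw [relativeBelief, div_le_iff₀ (hcells C hC)] at hle
    exact hle.trans (mul_le_of_le_one_right hr0 measureReal_le_one)
  classical
  set S := (Finset.range M).filter fun i =>
    i₀ ≤ i ∧ relativeBelief prior posterior (cell prior M i) ≤ r
  have hsub : {d | ∃ C ∈ discretization prior M i₀, d ∈ C ∧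
      relativeBelief prior posterior C ≤ r} ⊆
      firstCell prior M i₀ ∪ ⋃ i ∈ S, cell prior M i := by
    rintro d ⟨C, rfl | ⟨i, hi, hiM, rfl⟩, hd, hle⟩
    · exact Or.inl hd
    · exact Or.inr (mem_biUnion (by simp [S, hi, hiM, hle]) hd)
  calc strength prior posterior M i₀
      ≤ posterior.real (firstCell prior M i₀) + ∑ i ∈ S, posterior.real (cell prior M i) :=
        (measureReal_mono hsub).trans ((measureReal_union_le _ _).trans
          (add_le_add le_rfl (measureReal_biUnion_finset_le _ _)))
    _ ≤ r + ∑ i ∈ S, r := by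
        refine add_le_add (hbound _ (Or.inl rfl) le_rfl) (Finset.sum_le_sum fun i hi => ?_)
        simp only [S, Finset.mem_filter, Finset.mem_range] at hi
        exact hbound _ (Or.inr ⟨i, hi.2.1, hi.1, rfl⟩) hi.2.2
    _ ≤ (M + 1) * r := by
        rw [Finset.sum_const, nsmul_eq_mul]
        have : (S.card : ℝ) ≤ M := by
          exact_mod_cast (Finset.card_filter_le _ _).trans_eq (Finset.card_range M)
        nlinarith

lemma firstCell_le_strength (prior posterior : Measure ℝ) [IsProbabilityMeasure posterior]
    (M i₀ : ℕ) : posterior.real (firstCell prior M i₀) ≤ strength prior posterior M i₀ :=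
  measureReal_mono fun _ hd => ⟨_, Or.inl rfl, hd, le_rfl⟩

/-! ### Limits of the relative belief ratio and the strength -/

theorem mainTheorem1 {Ω : Type*} [MeasurableSpace Ω] (μ : Measure Ω) [IsProbabilityMeasure μ]
    -- the true distributions, with continuous cdf's
    (F G : Measure ℝ) [IsProbabilityMeasure F] [IsProbabilityMeasure G]
    (hF : Continuous (cdf F)) (hG : Continuous (cdf G))
    -- two independent i.i.d. samples
    (x y : ℕ → Ω → ℝ) (hx : ∀ i, Measurable (x i)) (hy : ∀ j, Measurable (y j))
    (hxF : ∀ i, μ.map (x i) = F) (hyG : ∀ j, μ.map (y j) = G)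
    (hindep : iIndepFun (Sum.elim x y) μ)
    -- the Dirichlet process priors
    (a₁ a₂ : ℝ) (ha₁ : 0 < a₁) (ha₂ : 0 < a₂)
    (H₁ H₂ : Measure ℝ) [IsProbabilityMeasure H₁] [IsProbabilityMeasure H₂]
    (priorP priorQ : Measure (ProbabilityMeasure ℝ))
    (hpriorP : IsDirichletProcess a₁ H₁ priorP) (hpriorQ : IsDirichletProcess a₂ H₂ priorQ)
    -- the Dirichlet process posteriors, for every sample size and all data
    (postP postQ : (n : ℕ) → (Fin n → ℝ) → Measure (ProbabilityMeasure ℝ))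
    (hpostP : ∀ n (u : Fin n → ℝ),
      IsDirichletProcess (a₁ + n) (posteriorBase a₁ H₁ u) (postP n u))
    (hpostQ : ∀ n (u : Fin n → ℝ),
      IsDirichletProcess (a₂ + n) (posteriorBase a₂ H₂ u) (postQ n u))
    -- the discretization, all of whose cells have positive prior content
    (M i₀ : ℕ) (hi₀ : 1 ≤ i₀) (hi₀M : i₀ < M)
    (hcells : ∀ C ∈ discretization (cvmLaw priorP priorQ) M i₀,
      0 < (cvmLaw priorP priorQ).real C) :
    let prior : Measure ℝ := cvmLaw priorP priorQ
    let posterior : ℕ × ℕ → Ω → Measure ℝ := fun n ω =>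
      cvmLaw (postP n.1 fun i => x i ω) (postQ n.2 fun j => y j ω)
    (F = G →
      (∀ᵐ ω ∂μ, Tendsto
        (fun n : ℕ × ℕ => relativeBelief prior (posterior n ω) (firstCell prior M i₀))
        atTop (𝓝 (1 / prior.real (firstCell prior M i₀)))) ∧
      (∀ i, i₀ ≤ i → i < M → ∀ᵐ ω ∂μ, Tendsto
        (fun n : ℕ × ℕ => relativeBelief prior (posterior n ω) (cell prior M i))
        atTop (𝓝 0)) ∧
      (∀ᵐ ω ∂μ, Tendsto
        (fun n : ℕ × ℕ => strength prior (posterior n ω) M i₀) atTop (𝓝 1))) ∧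
    (F ≠ G → quantile prior ((i₀ : ℝ) / M) < cvmDist F G →
      (∀ᵐ ω ∂μ, Tendsto
        (fun n : ℕ × ℕ => relativeBelief prior (posterior n ω) (firstCell prior M i₀))
        atTop (𝓝 0)) ∧
      (∀ᵐ ω ∂μ, Tendsto
        (fun n : ℕ × ℕ => strength prior (posterior n ω) M i₀) atTop (𝓝 0))) := by
  intro prior posterior
  have := hpriorP.isProbabilityMeasure
  have := hpriorQ.isProbabilityMeasure
  have hprior : IsProbabilityMeasure prior := isProbabilityMeasure_cvmLaw _ _
  have hposterior : ∀ n ω, IsProbabilityMeasure (posterior n ω) := fun n ω =>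
    have := (hpostP n.1 fun i => x i ω).isProbabilityMeasure
    have := (hpostQ n.2 fun j => y j ω).isProbabilityMeasure
    isProbabilityMeasure_cvmLaw _ _
  have hxi : iIndepFun x μ :=
    iIndepFun.precomp (f := Sum.elim x y) Sum.inl_injective hindep
  have hyi : iIndepFun y μ :=
    iIndepFun.precomp (f := Sum.elim x y) Sum.inr_injective hindep
  have hconc := fun {ε : ℝ} (hε : 0 < ε) => ae_tendsto_cvmLaw_le_abs_sub hF hG hx hy hxF hyG hxi hyi
    ha₁ ha₂ hpostP hpostQ hε
  set q := quantile prior ((i₀ : ℝ) / M) with hq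
  have hfirst : 0 < prior.real (firstCell prior M i₀) := hcells _ (Or.inl rfl)
  have hq0 : 0 < q := by
    by_contra h
    simp [firstCell, ← hq, Ico_eq_empty h] at hfirst
  refine ⟨fun hFG => ?_, fun _ hlt => ?_⟩
  · -- the posterior content of `[q, ∞)` vanishes in the limit
    have hfar : ∀ᵐ ω ∂μ, Tendsto (fun n => (posterior n ω).real (Ici q)) atTop (𝓝 0) := by
      filter_upwards [hconc hq0] with ω hω
      refine squeeze_zero (fun _ => measureReal_nonneg) (fun n => ?_) hω
      refine measureReal_mono fun d hd => ?_
      have hzero : cvmDist F G = 0 := by simp [cvmDist, hFG]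
      simp only [mem_ofPred_eq, hzero, sub_zero]
      exact (mem_Ici.1 hd).trans (le_abs_self d)
    have hnear : ∀ᵐ ω ∂μ, Tendsto (fun n => (posterior n ω).real (firstCell prior M i₀)) atTop
        (𝓝 1) := by
      filter_upwards [hfar] with ω hω
      have hone : Tendsto (fun n => 1 - (posterior n ω).real (Ici q)) atTop (𝓝 1) := by
        simpa using tendsto_const_nhds.sub hω
      refine hone.congr fun n => ?_
      rw [← probReal_compl_eq_one_sub measurableSet_Ici, compl_Ici, ← Iio_union_Ico_eq_Iio hq0.le,
        measureReal_union (by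
          rw [Set.disjoint_left]
          exact fun d hd hd' => absurd hd'.1 (not_le.2 hd)) measurableSet_Ico,
        cvmLaw_real_Iio_zero, zero_add]
      rfl
    refine ⟨?_, fun i hi hiM => ?_, ?_⟩
    · filter_upwards [hnear] with ω hω
      exact hω.div_const _
    · filter_upwards [hfar] with ω hω
      have hcell : Tendsto (fun n => (posterior n ω).real (cell prior M i)) atTop (𝓝 0) :=
        squeeze_zero (fun _ => measureReal_nonneg)
          (fun n => measureReal_mono (cell_subset_Ici prior hi₀ hi hiM)) hω
      simpa [relativeBelief] using hcell.div_const (prior.real (cell prior M i))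
    · filter_upwards [hnear] with ω hω
      exact tendsto_of_tendsto_of_tendsto_of_le_of_le hω tendsto_const_nhds
        (fun n => firstCell_le_strength _ _ _ _) fun n => measureReal_le_one
  · have hrb : ∀ᵐ ω ∂μ, Tendsto
        (fun n => relativeBelief prior (posterior n ω) (firstCell prior M i₀)) atTop (𝓝 0) := by
      filter_upwards [hconc (sub_pos.2 hlt)] with ω hω
      have hfc : Tendsto (fun n => (posterior n ω).real (firstCell prior M i₀)) atTop (𝓝 0) := by
        refine squeeze_zero (fun _ => measureReal_nonneg) (fun n => ?_) hω
        refine measureReal_mono fun d hd => ?_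
        have hdq : d < q := hd.2
        rw [mem_ofPred_eq, abs_sub_comm]
        exact le_trans (by linarith) (le_abs_self _)
      simpa [relativeBelief] using hfc.div_const (prior.real (firstCell prior M i₀))
    refine ⟨hrb, ?_⟩
    filter_upwards [hrb] with ω hω
    have hM := hω.const_mul ((M : ℝ) + 1)
    rw [mul_zero] at hM
    exact squeeze_zero (fun _ => measureReal_nonneg) (fun n => strength_le hcells) hM
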